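/- Let $q:\mathbb{R}\to(0,\infty)$ be a continuously differentiable probability density, let $\varsigma:\mathbb{R}\to\mathbb{R}$ be continuously differentiable and nowhere zero, and put $\Sigma=\varsigma^2$. Let $L^2$ be the space of Borel functions that are square integrable with respect to $q(x)\,dx$, with inner product $\langle\phi,\psi\rangle=\int\phi\psi q\,dx$. Let $\mathcal{D}(f)$ be the set of $\phi\in L^2$ for which there is a measurable $g$ with $\int g^2\,\Sigma\, q\,dx<\infty$ and $\int\phi\,\psi'\,dx=-\int g\,\psi\,dx$ for all $\psi\in C^1_K(\mathbb{R})$ (continuously differentiable functions with compact support); this weak derivative $g=:\phi'$ is unique almost everywhere. For $\phi,\psi\in\mathcal{D}(f)$ let $$f(\phi,\psi)=\tfrac12\int_{\mathbb{R}}\phi'\,\Sigma\,\psi'\,q\,dx .$$ Suppose that $$\int_0^\infty\frac{dx}{\varsigma^2(x)q(x)}=+\infty,\qquad \int_0^\infty\frac{dx}{\varsigma^2(-x)q(-x)}=+\infty,$$ and that $$\lim_{|x|\to\infty}-\frac{x}{|x|}\left[\varsigma(x)\frac{q'(x)}{q(x)}+\varsigma'(x)\right]=+\infty .$$ Then for every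 $\theta>0$ the set $\{\phi\in\mathcal{D}(f): f(\phi,\phi)+\theta\langle\phi,\phi\rangle\le 1\}$ is precompact (has compact closure) in $L^2$. -/

import Mathlib

open MeasureTheory Filter Topology

noncomputable section

namespace NPC

/-- The probability law `Q` on the real line with Lebesgue density `q`. -/
def law (q : ℝ → ℝ) : Measure ℝ :=
  volume.withDensity fun x => ENNReal.ofReal (q x)

/-- The Hilbert space `L²` of functions that are square integrable for the law `Q`. -/
abbrev L2 (q : ℝ → ℝ) : Type := Lp ℝ 2 (law q)

/-- `g` is a weak derivative of `φ` on the real line: `∫ φ ψ' = - ∫ g ψ` for all continuously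
differentiable, compactly supported `ψ` (integrals for the Lebesgue measure). -/
def IsWeakDeriv (φ g : ℝ → ℝ) : Prop :=
  ∀ ψ : ℝ → ℝ, ContDiff ℝ 1 ψ → HasCompactSupport ψ →
    ∫ x, φ x * deriv ψ x = - ∫ x, g x * ψ x

/-- Locally integrable weak derivatives are unique almost everywhere. -/
theorem IsWeakDeriv.ae_eq {φ g₁ g₂ : ℝ → ℝ} (h₁ : IsWeakDeriv φ g₁) (h₂ : IsWeakDeriv φ g₂)
    (hg₁ : LocallyIntegrable g₁ volume) (hg₂ : LocallyIntegrable g₂ volume) :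
    g₁ =ᵐ[volume] g₂ := by
  refine ae_eq_of_integral_contDiff_smul_eq hg₁ hg₂ fun ψ hψ hc => ?_
  have hψ1 : ContDiff ℝ 1 ψ := hψ.of_le (by exact_mod_cast le_top)
  have e := (h₁ ψ hψ1 hc).symm.trans (h₂ ψ hψ1 hc)
  simpa [mul_comm] using e

/-- The domain `D(f)` of the form: all `φ` in `L²` that have a measurable weak derivative `g`
with `∫ g² S q < ∞`, where `S` is the (scalar) penalty and `q` the density. -/
def formDomain (q S : ℝ → ℝ) : Set (L2 q) :=
  {φ | ∃ g : ℝ → ℝ, Measurable g ∧ Integrable (fun x => g x ^ 2 * S x * q x) volume ∧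
    IsWeakDeriv (φ : ℝ → ℝ) g}

/-- For positive continuous `S` and `q` a weak derivative as in `formDomain` is locally
integrable, hence unique almost everywhere. -/
theorem locallyIntegrable_of_energy {q S g : ℝ → ℝ} (hq : Continuous q) (hq0 : ∀ x, 0 < q x)
    (hS : Continuous S) (hS0 : ∀ x, 0 < S x) (hg : Measurable g)
    (hi : Integrable (fun x => g x ^ 2 * S x * q x) volume) :
    LocallyIntegrable g volume := by
  have hc : Continuous fun x => (S x * q x)⁻¹ :=
    (hS.mul hq).inv₀ fun x => (mul_pos (hS0 x) (hq0 x)).ne'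
  have h2 : LocallyIntegrable (fun x => g x ^ 2) volume := by
    rw [locallyIntegrable_iff]
    intro k hk
    have := (hi.integrableOn (s := k)).mul_continuousOn hc.continuousOn hk
    refine this.congr_fun_ae (Eventually.of_forall fun x => ?_)
    have h1 := (hS0 x).ne'
    have h2 := (hq0 x).ne'
    change g x ^ 2 * S x * q x * (S x * q x)⁻¹ = g x ^ 2
    field_simp
  refine (h2.add (locallyIntegrable_const (1 : ℝ))).mono hg.aestronglyMeasurable
    (Eventually.of_forall fun x => ?_)
  simp only [Pi.add_apply, Real.norm_eq_abs]
  rw [abs_of_nonneg (by positivity : 0 ≤ g x ^ 2 + 1), abs_le]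
  constructor <;> nlinarith [sq_nonneg (g x - 1), sq_nonneg (g x + 1)]

open Classical in
/-- The weak derivative of an element of `D(f)` (zero off `D(f)`). -/
def weakGrad (q S : ℝ → ℝ) (φ : L2 q) : ℝ → ℝ :=
  if h : φ ∈ formDomain q S then h.choose else 0

/-- The form `f(φ, ψ) = ½ ∫ φ' S ψ' q` with weak derivatives, meaningful on `D(f)`. -/
def form (q S : ℝ → ℝ) (φ ψ : L2 q) : ℝ :=
  (1 / 2) * ∫ x, weakGrad q S φ x * S x * weakGrad q S ψ x * q x

/-- The constraint set `{φ ∈ D(f) : f(φ, φ) + θ ⟨φ, φ⟩ ≤ 1}`. -/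
def constraintSet (q S : ℝ → ℝ) (θ : ℝ) : Set (L2 q) :=
  {φ | φ ∈ formDomain q S ∧ form q S φ φ + θ * inner ℝ φ φ ≤ 1}

/-- The compactness condition: for every `θ > 0` the constraint set has compact closure
in `L²`. -/
def CompactnessCondition (q S : ℝ → ℝ) : Prop :=
  ∀ θ : ℝ, 0 < θ → IsCompact (closure (constraintSet q S θ))

end NPC

end

/-! Each class in the constraint set has a continuous representative `u`, a primitive of its weak
derivative `g`, with `∫ u² q` and `∫ g² ς² q` bounded by one constant. On a bounded interval `ς² q`
is bounded below, so these `u` are uniformly bounded and equicontinuous there. Compactness in `L²`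
then reduces to uniformly small tails.

For the tails put `w = ς q`; the bracket in the hypothesis is `w' / q`. If `ς > 0`, integrating `(u²
w)'` over `[a, N]` and using `2 u g w ≤ u² q + g² ς² q` bounds `∫ u² (-w')` by the energy and a
boundary term at `a` (`IsPrimitive.integral_sq_mul_le`). Far out `-w' ≥ C q` with `C` arbitrarily
large, so the mass there is `O(1 / C)`. The left tail follows by reflection.

The divergence of `∫ 1 / (ς² q)` serves to exclude `ς < 0` (`lintegral_one_div_ne_top_of_neg`).
`totallyBounded_of_hasEnergyLE` combines the estimates. -/

namespace NPC

/-! ### Primitives, integration by parts and weak derivatives. -/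

open Set intervalIntegral

/-- `u` is a primitive of the locally integrable function `g`. -/
def IsPrimitive (u g : ℝ → ℝ) : Prop :=
  LocallyIntegrable g volume ∧ ∀ x y, u y - u x = ∫ t in x..y, g t

theorem _root_.MeasureTheory.LocallyIntegrable.intervalIntegrable_of_real {g : ℝ → ℝ}
    (hg : LocallyIntegrable g volume) (a b : ℝ) : IntervalIntegrable g volume a b :=
  (hg.integrableOn_isCompact isCompact_uIcc).intervalIntegrable

namespace IsPrimitive

variable {u g : ℝ → ℝ}

theorem absolutelyContinuousOnInterval (h : IsPrimitive u g) (a b : ℝ) :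
    AbsolutelyContinuousOnInterval u a b := by
  have h1 := (h.1.intervalIntegrable_of_real a b).absolutelyContinuousOnInterval_intervalIntegral
    (c := a) left_mem_uIcc
  have h2 : AbsolutelyContinuousOnInterval (fun _ : ℝ => u a) a b :=
    (contDiff_const.contDiffOn (n := 1)).absolutelyContinuousOnInterval
  have e : (fun x => u a + ∫ t in a..x, g t) = u := funext fun x => by rw [← h.2 a x]; ring
  exact e ▸ h2.fun_add h1

theorem continuous (h : IsPrimitive u g) : Continuous u := by
  have h1 : Continuous fun x => ∫ t in (0 : ℝ)..x, g t :=
    continuous_primitive (fun a b => h.1.intervalIntegrable_of_real a b) 0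
  convert h1.const_add (u 0) using 2 with x
  rw [← h.2 0 x]; ring

theorem ae_hasDerivAt (h : IsPrimitive u g) : ∀ᵐ x, HasDerivAt u (g x) x := by
  filter_upwards [LocallyIntegrable.ae_hasDerivAt_integral h.1] with x hx
  have e : u = fun y => u 0 + ∫ t in (0 : ℝ)..y, g t := by
    funext y; rw [← h.2 0 y]; ring
  rw [e]
  exact (hx 0).const_add _

theorem comp_neg (h : IsPrimitive u g) : IsPrimitive (fun x => u (-x)) (fun x => -g (-x)) := by
  refine ⟨?_, fun x y => ?_⟩
  · refine LocallyIntegrable.neg (f := fun x => g (-x)) ?_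
    rw [locallyIntegrable_iff]
    intro k hk
    have h1 := h.1.integrableOn_isCompact hk.neg
    have := (Measure.measurePreserving_neg (volume : Measure ℝ)).integrableOn_comp_preimage
      (MeasurableEquiv.neg ℝ).measurableEmbedding (f := g) (s := -k)
    simpa [Function.comp_def] using this.2 h1
  · rw [intervalIntegral.integral_neg, intervalIntegral.integral_comp_neg (fun x => g x),
      h.2, integral_symm]

/-- A primitive of `g` against a test function: integration by parts. -/
theorem integral_mul_deriv (h : IsPrimitive u g) {ψ : ℝ → ℝ} (hψ : ContDiff ℝ 1 ψ)
    (hc : HasCompactSupport ψ) : ∫ x, u x * deriv ψ x = -∫ x, g x * ψ x := by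
  obtain ⟨r, hr0, hr⟩ : ∃ r : ℝ, 0 < r ∧ tsupport ψ ⊆ Ioc (-r) r := by
    obtain ⟨r, hr⟩ := hc.isCompact.isBounded.subset_closedBall 0
    refine ⟨|r| + 1, by positivity, fun x hx => ?_⟩
    have := hr hx
    rw [Metric.mem_closedBall, dist_zero_right, Real.norm_eq_abs] at this
    have h1 := abs_le.1 (this.trans (le_abs_self r))
    exact ⟨by linarith, by linarith⟩
  have hz : ∀ x, x ∉ Ioc (-r) r → ψ x = 0 := fun x hx =>
    image_eq_zero_of_notMem_tsupport fun hx' => hx (hr hx')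
  have hz' : ∀ x, x ∉ Ioc (-r) r → deriv ψ x = 0 := fun x hx =>
    image_eq_zero_of_notMem_tsupport fun hx' => hx (hr (tsupport_deriv_subset hx'))
  have hle : -r ≤ r := by linarith
  -- The endpoint `r` belongs to `Ioc (-r) r`, so vanishing there comes from the right by
  -- continuity.
  have hψr : ψ r = 0 := by
    by_contra hne
    have hcont := hψ.continuous.continuousAt.eventually_ne hne
    obtain ⟨y, hy, hy'⟩ := (hcont.filter_mono nhdsWithin_le_nhds |>.and
      (self_mem_nhdsWithin (s := Ioi r) (a := r))).exists
    exact hy (hz y fun h => not_lt.2 h.2 hy')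
  have hψr' : ψ (-r) = 0 := hz _ (by simp)
  have e1 : ∫ x, u x * deriv ψ x = ∫ x in -r..r, u x * deriv ψ x := by
    rw [integral_of_le hle, setIntegral_eq_integral_of_forall_compl_eq_zero]
    intro x hx; simp [hz' x hx]
  have e2 : ∫ x, g x * ψ x = ∫ x in -r..r, g x * ψ x := by
    rw [integral_of_le hle, setIntegral_eq_integral_of_forall_compl_eq_zero]
    intro x hx; simp [hz x hx]
  rw [e1, e2, AbsolutelyContinuousOnInterval.integral_mul_deriv_eq_deriv_mul
    (h.absolutelyContinuousOnInterval _ _) hψ.contDiffOn.absolutelyContinuousOnInterval, hψr, hψr']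
  simp only [mul_zero, sub_zero, zero_sub, neg_inj]
  refine intervalIntegral.integral_congr_ae ?_
  filter_upwards [h.ae_hasDerivAt] with x hx _
  rw [hx.deriv]

/-- The Caccioppoli type inequality behind the tail estimate. -/
theorem integral_sq_mul_le (h : IsPrimitive u g) {q w ς : ℝ → ℝ} {a R N C : ℝ}
    (hq : Continuous q) (hw : ContDiff ℝ 1 w) (hws : ∀ x, w x = ς x * q x)
    (hq0 : ∀ x, 0 < q x) (hς0 : ∀ x, 0 < ς x) (haR : a ≤ R) (hRN : R ≤ N)
    (hwa : ∀ x, a ≤ x → deriv w x ≤ 0) (hwR : ∀ x, R ≤ x → C * q x ≤ -deriv w x)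
    (hi : IntervalIntegrable (fun x => g x ^ 2 * ς x ^ 2 * q x) volume a N) :
    C * ∫ x in R..N, u x ^ 2 * q x ≤
      u a ^ 2 * w a + (∫ x in a..N, u x ^ 2 * q x) + ∫ x in a..N, g x ^ 2 * ς x ^ 2 * q x := by
  have hu := h.continuous
  have hw' : Continuous (deriv w) := hw.continuous_deriv le_rfl
  have haN := haR.trans hRN
  have iu : ∀ b c, IntervalIntegrable (fun x => u x ^ 2 * q x) volume b c := fun b c =>
    ((hu.pow 2).mul hq).intervalIntegrable b c
  have iw : ∀ b c, IntervalIntegrable (fun x => u x ^ 2 * -deriv w x) volume b c := fun b c =>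
    ((hu.pow 2).mul hw'.neg).intervalIntegrable b c
  have hac := h.absolutelyContinuousOnInterval a N
  have key := (hac.fun_mul hac).integral_deriv_mul_eq_sub
    (hw.contDiffOn (s := uIcc a N)).absolutelyContinuousOnInterval
  have ig : IntervalIntegrable (fun x => 2 * u x * g x * w x) volume a N :=
    (((h.1.intervalIntegrable_of_real a N).continuousOn_mul
      (continuous_const.mul hu).continuousOn).mul_continuousOn hw.continuous.continuousOn)
  have e : ∫ x in a..N, deriv (fun x => u x * u x) x * w x + u x * u x * deriv w x =
      (∫ x in a..N, 2 * u x * g x * w x) - ∫ x in a..N, u x ^ 2 * -deriv w x := by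
    rw [← intervalIntegral.integral_sub ig (iw a N)]
    refine intervalIntegral.integral_congr_ae ?_
    filter_upwards [h.ae_hasDerivAt] with x hx _
    rw [(hx.fun_mul hx).deriv]; ring
  rw [e] at key
  have s1 : C * ∫ x in R..N, u x ^ 2 * q x ≤ ∫ x in R..N, u x ^ 2 * -deriv w x := by
    rw [← intervalIntegral.integral_const_mul]
    refine integral_mono_on hRN ((iu R N).const_mul C) (iw R N) fun x hx => ?_
    nlinarith [mul_le_mul_of_nonneg_left (hwR x hx.1) (sq_nonneg (u x))]
  have s2 : ∫ x in R..N, u x ^ 2 * -deriv w x ≤ ∫ x in a..N, u x ^ 2 * -deriv w x := by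
    rw [← integral_add_adjacent_intervals (iw a R) (iw R N)]
    have : 0 ≤ ∫ x in a..R, u x ^ 2 * -deriv w x := integral_nonneg haR fun x hx =>
      mul_nonneg (sq_nonneg _) (neg_nonneg.2 (hwa x hx.1))
    linarith
  have s3 : ∫ x in a..N, 2 * u x * g x * w x ≤
      (∫ x in a..N, u x ^ 2 * q x) + ∫ x in a..N, g x ^ 2 * ς x ^ 2 * q x := by
    rw [← intervalIntegral.integral_add (iu a N) hi]
    refine integral_mono_on haN ig ((iu a N).add hi) fun x _ => ?_
    rw [hws]
    nlinarith [mul_nonneg (hq0 x).le (sq_nonneg (u x - g x * ς x))]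
  -- The boundary term at `N` can be dropped because `ς > 0`; hence the bound is uniform in `N`.
  have s4 : 0 ≤ u N * u N * w N := by
    rw [hws]
    exact mul_nonneg (mul_self_nonneg _) (mul_pos (hς0 N) (hq0 N)).le
  nlinarith

end IsPrimitive

/-- A function with a locally integrable weak derivative agrees almost everywhere with a
primitive of it. -/
theorem IsWeakDeriv.exists_isPrimitive {φ g : ℝ → ℝ} (h : IsWeakDeriv φ g)
    (hφ : LocallyIntegrable φ volume) (hg : LocallyIntegrable g volume) :
    ∃ u, IsPrimitive u g ∧ φ =ᵐ[volume] u := by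
  set v : ℝ → ℝ := fun x => ∫ t in (0 : ℝ)..x, g t with hv
  have hvg : IsPrimitive v g := ⟨hg, fun x y =>
    integral_interval_sub_left (hg.intervalIntegrable_of_real _ _)
      (hg.intervalIntegrable_of_real _ _)⟩
  have hd : LocallyIntegrable (fun x => φ x - v x) volume :=
    hφ.sub hvg.continuous.locallyIntegrable
  have int : ∀ (f : ℝ → ℝ), LocallyIntegrable f volume → ∀ η : ℝ → ℝ, Continuous η →
      HasCompactSupport η → Integrable (fun x => f x * η x) := fun f hf η hη hc => by
    simpa using hf.integrable_smul_right_of_hasCompactSupport hη hc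
  -- Du Bois-Reymond argument: a zero-mean `η` is the derivative of a compactly supported `ψ`,
  -- against which `φ` and `v` give the same integral.
  have zero_mean : ∀ η : ℝ → ℝ, Continuous η → HasCompactSupport η → ∫ x, η x = 0 →
      ∫ x, (φ x - v x) * η x = 0 := by
    intro η hη hc h0
    obtain ⟨r, hr⟩ : ∃ r : ℝ, ∀ x, r < |x| → η x = 0 := by
      obtain ⟨r, hr⟩ := hc.isCompact.isBounded.subset_closedBall 0
      refine ⟨r, fun x hx => image_eq_zero_of_notMem_tsupport fun hx' => ?_⟩
      have := hr hx'
      rw [Metric.mem_closedBall, dist_zero_right, Real.norm_eq_abs] at this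
      linarith
    have iη : Integrable η := hη.integrable_of_hasCompactSupport hc
    set ψ : ℝ → ℝ := fun x => ∫ t in Iic x, η t with hψ
    have hψd : ∀ x, HasDerivAt ψ (η x) x := fun x => by
      have e : ψ = fun y => ψ 0 + ∫ t in (0 : ℝ)..y, η t := by
        funext y
        rw [← integral_Iic_sub_Iic iη.integrableOn iη.integrableOn]
        simp [hψ]
      rw [e]
      exact (hη.integral_hasStrictDerivAt 0 x).hasDerivAt.const_add _
    have hder : deriv ψ = η := funext fun x => (hψd x).deriv
    have hψ1 : ContDiff ℝ 1 ψ := contDiff_one_iff_deriv.2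
      ⟨fun x => (hψd x).differentiableAt, by rwa [hder]⟩
    have hψc : HasCompactSupport ψ := by
      refine HasCompactSupport.intro (isCompact_Icc (a := -|r|) (b := |r|)) fun x hx => ?_
      rw [mem_Icc, not_and_or, not_le, not_le] at hx
      have hrr := le_abs_self r
      rcases hx with hx | hx
      · refine setIntegral_eq_zero_of_forall_eq_zero fun t ht => hr t ?_
        have : t ≤ x := ht
        have := neg_le_abs t
        linarith
      · rw [hψ, ← h0]
        refine setIntegral_eq_integral_of_forall_compl_eq_zero fun t ht => hr t ?_
        have : x < t := not_le.1 ht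
        have := le_abs_self t
        linarith
    have e1 := h ψ hψ1 hψc
    have e2 := hvg.integral_mul_deriv hψ1 hψc
    rw [hder] at e1 e2
    simp_rw [sub_mul]
    rw [integral_sub (int φ hφ η hη hc) (int v hvg.continuous.locallyIntegrable η hη hc), e1, e2,
      sub_self]
  obtain ⟨ρ, hρ, hρc, hρ1⟩ : ∃ ρ : ℝ → ℝ, Continuous ρ ∧ HasCompactSupport ρ ∧ ∫ x, ρ x = 1 := by
    let b : ContDiffBump (0 : ℝ) := default
    exact ⟨b.normed volume, b.continuous_normed, b.hasCompactSupport_normed, b.integral_normed⟩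
  -- Subtracting `(∫ η) ρ` makes any test function `η` zero-mean, so `φ - v` acts on it as the
  -- constant `c`.
  set c := ∫ x, (φ x - v x) * ρ x with hc
  refine ⟨fun x => v x + c, ⟨hg, fun x y => by rw [← hvg.2]; ring⟩, ?_⟩
  have hz : ∀ᵐ x, φ x - v x - c = 0 := by
    refine ae_eq_zero_of_integral_contDiff_smul_eq_zero (hd.sub (locallyIntegrable_const c))
      fun η hη hηc => ?_
    have hη0 := hη.continuous
    set m := ∫ x, η x with hm
    have iη : Integrable η := hη0.integrable_of_hasCompactSupport hηc
    have iρ : Integrable ρ := hρ.integrable_of_hasCompactSupport hρc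
    have e := zero_mean (fun x => η x - m * ρ x) (hη0.sub (continuous_const.mul hρ))
      (hηc.sub hρc.mul_left) (by
        rw [integral_sub iη (iρ.const_mul m), MeasureTheory.integral_const_mul, hρ1, ← hm]; ring)
    have i1 := int _ hd η hη0 hηc
    have i2 := int _ hd ρ hρ hρc
    have e' : ∫ x, (φ x - v x) * η x - m * ((φ x - v x) * ρ x) = 0 := by
      rw [← e]; exact integral_congr_ae (.of_forall fun x => by ring)
    rw [integral_sub i1 (i2.const_mul m), MeasureTheory.integral_const_mul, ← hc] at e'
    have : ∫ x, η x • (φ x - v x - c) = (∫ x, (φ x - v x) * η x) - c * m := by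
      rw [hm, ← MeasureTheory.integral_const_mul, ← integral_sub i1 (iη.const_mul c)]
      exact integral_congr_ae (.of_forall fun x => by simp only [smul_eq_mul]; ring)
    exact this.trans (by linarith)
  filter_upwards [hz] with x hx
  linarith

end NPC
-- Uniform local bounds and tail estimates for bounded energy.
namespace NPC

open Set intervalIntegral

/-- `u` is a primitive of `g`, and both the squared `L²(q)`-norm of `u` and the energy of `g` are
at most `K`. -/
structure HasEnergyLE (q ς : ℝ → ℝ) (K : ℝ) (u g : ℝ → ℝ) : Prop where
  isPrimitive : IsPrimitive u g
  integrable_sq : Integrable fun x => u x ^ 2 * q x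
  integral_sq_le : ∫ x, u x ^ 2 * q x ≤ K
  integrable_energy : Integrable fun x => g x ^ 2 * ς x ^ 2 * q x
  integral_energy_le : ∫ x, g x ^ 2 * ς x ^ 2 * q x ≤ K

namespace HasEnergyLE

variable {q ς u g : ℝ → ℝ} {K : ℝ}

theorem comp_neg (h : HasEnergyLE q ς K u g) :
    HasEnergyLE (fun x => q (-x)) (fun x => ς (-x)) K (fun x => u (-x)) (fun x => -g (-x)) where
  isPrimitive := h.isPrimitive.comp_neg
  integrable_sq := h.integrable_sq.comp_neg
  integral_sq_le := (integral_neg_eq_self (fun x => u x ^ 2 * q x) volume).trans_le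
    h.integral_sq_le
  integrable_energy := by simpa using h.integrable_energy.comp_neg
  integral_energy_le := by
    simpa using (integral_neg_eq_self (fun x => g x ^ 2 * ς x ^ 2 * q x) volume).trans_le
      h.integral_energy_le

/-- Young's inequality `|g| ≤ s g² + 1 / (4 s)` is integrated. The free parameter `s` is taken small
for equicontinuity and equal to `1` for boundedness. -/
theorem sub_le (h : HasEnergyLE q ς K u g) (hq0 : ∀ x, 0 < q x) {m s x y : ℝ} (hm : 0 < m)
    (hs : 0 < s) (hxy : x ≤ y) (hmin : ∀ t ∈ Icc x y, m ≤ ς t ^ 2 * q t) :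
    |u y - u x| ≤ s / m * K + (y - x) / (4 * s) := by
  rw [h.isPrimitive.2]
  have ii := h.integrable_energy.intervalIntegrable (a := x) (b := y)
  have h1 : ∫ t in x..y, g t ^ 2 * ς t ^ 2 * q t ≤ K := by
    rw [integral_of_le hxy]
    refine (setIntegral_le_integral h.integrable_energy (.of_forall fun t => ?_)).trans
      h.integral_energy_le
    exact mul_nonneg (by positivity) (hq0 t).le
  calc |∫ t in x..y, g t| ≤ ∫ t in x..y, |g t| := abs_integral_le_integral_abs hxy
    _ ≤ ∫ t in x..y, (s / m * (g t ^ 2 * ς t ^ 2 * q t) + 1 / (4 * s)) := by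
      refine integral_mono_on hxy (h.isPrimitive.1.intervalIntegrable_of_real x y).abs
        ((ii.const_mul _).add intervalIntegrable_const) fun t ht => ?_
      have e1 : s * g t ^ 2 ≤ s / m * (g t ^ 2 * ς t ^ 2 * q t) := by
        rw [div_mul_eq_mul_div, le_div_iff₀ hm]
        nlinarith [mul_le_mul_of_nonneg_left (hmin t ht) (mul_nonneg hs.le (sq_nonneg (g t)))]
      have e2 : |g t| ≤ s * g t ^ 2 + 1 / (4 * s) := by
        have : s * g t ^ 2 + 1 / (4 * s) - |g t| = (2 * s * |g t| - 1) ^ 2 / (4 * s) := by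
          rw [← sq_abs (g t)]; field_simp; ring
        have : 0 ≤ (2 * s * |g t| - 1) ^ 2 / (4 * s) := by positivity
        linarith
      linarith
    _ = s / m * (∫ t in x..y, g t ^ 2 * ς t ^ 2 * q t) + (y - x) / (4 * s) := by
      rw [intervalIntegral.integral_add (ii.const_mul _) intervalIntegrable_const,
        intervalIntegral.integral_const_mul, intervalIntegral.integral_const, smul_eq_mul]
      ring
    _ ≤ _ := by gcongr

end HasEnergyLE

section Uniform

variable {q ς : ℝ → ℝ}

theorem exists_pos_le_of_isCompact {p : ℝ → ℝ} (hp : Continuous p) (hp0 : ∀ x, 0 < p x)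
    (a b : ℝ) : ∃ m, 0 < m ∧ ∀ x ∈ Icc a b, m ≤ p x := by
  rcases (Icc a b).eq_empty_or_nonempty with h | h
  · exact ⟨1, one_pos, by simp [h]⟩
  · obtain ⟨x, _, hx⟩ := isCompact_Icc.exists_isMinOn h hp.continuousOn
    exact ⟨p x, hp0 x, fun y hy => hx hy⟩

/-- Functions of bounded energy are uniformly equicontinuous on bounded intervals. -/
theorem HasEnergyLE.exists_equicontinuous (hq : Continuous q) (hq0 : ∀ x, 0 < q x)
    (hς : Continuous ς) (hς0 : ∀ x, ς x ≠ 0) (K R : ℝ) {δ : ℝ} (hδ : 0 < δ) :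
    ∃ r, 0 < r ∧ ∀ u g, HasEnergyLE q ς K u g → ∀ x ∈ Icc (-R) R, ∀ y ∈ Icc (-R) R,
      x ≤ y → y - x ≤ r → |u y - u x| ≤ δ := by
  obtain ⟨m, hm, hmin⟩ := exists_pos_le_of_isCompact ((hς.pow 2).mul hq)
    (fun x => mul_pos (sq_pos_of_ne_zero (hς0 x)) (hq0 x)) (-R) R
  set s := δ / 2 * m / (|K| + 1) with hs
  have hs0 : 0 < s := by positivity
  refine ⟨2 * s * δ, by positivity, fun u g h x hx y hy hxy hr => ?_⟩
  refine (h.sub_le hq0 hm hs0 hxy fun t ht => hmin t ⟨hx.1.trans ht.1, ht.2.trans hy.2⟩).trans ?_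
  have e1 : s / m * K ≤ δ / 2 := by
    have : s / m * (|K| + 1) = δ / 2 := by rw [hs]; field_simp
    rw [← this]
    have := le_abs_self K
    gcongr
    linarith
  have e2 : (y - x) / (4 * s) ≤ δ / 2 := by
    rw [div_le_iff₀ (by positivity)]; linarith
  linarith

/-- Functions of bounded energy are uniformly bounded on bounded intervals. -/
theorem HasEnergyLE.exists_bound (hq : Continuous q) (hq0 : ∀ x, 0 < q x)
    (hς : Continuous ς) (hς0 : ∀ x, ς x ≠ 0) (K R : ℝ) :
    ∃ M, ∀ u g, HasEnergyLE q ς K u g → ∀ x ∈ Icc (-R) R, |u x| ≤ M := by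
  set T := |R| + 1
  have hT : 1 ≤ T := by simp [T]
  obtain ⟨m, hm, hmin⟩ := exists_pos_le_of_isCompact ((hς.pow 2).mul hq)
    (fun x => mul_pos (sq_pos_of_ne_zero (hς0 x)) (hq0 x)) (-T) T
  obtain ⟨n, hn, hmin'⟩ := exists_pos_le_of_isCompact hq hq0 0 1
  refine ⟨(K + 1) / n + 1 + (1 / m * |K| + 2 * T / (4 * 1)), fun u g h x hx => ?_⟩
  -- Averaging over an interval of length one gives a point where `u` is controlled; the oscillation
  -- bound on `[-T, T]`, which contains `[0, 1]` and `[-R, R]`, carries this to `x`.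
  obtain ⟨y, hy, hyK⟩ : ∃ y ∈ Icc (0 : ℝ) 1, u y ^ 2 * q y < K + 1 := by
    by_contra! hcon
    have h1 : ∫ x in (0 : ℝ)..1, u x ^ 2 * q x ≤ K := by
      rw [integral_of_le zero_le_one]
      exact (setIntegral_le_integral h.integrable_sq (.of_forall fun t =>
        mul_nonneg (sq_nonneg _) (hq0 t).le)).trans h.integral_sq_le
    have h2 : ∫ _ in (0 : ℝ)..1, (K + 1) ≤ ∫ x in (0 : ℝ)..1, u x ^ 2 * q x :=
      integral_mono_on zero_le_one intervalIntegrable_const h.integrable_sq.intervalIntegrable hcon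
    rw [intervalIntegral.integral_const] at h2
    simp only [sub_zero, one_smul] at h2
    linarith
  have huy : |u y| ≤ (K + 1) / n + 1 := by
    have : u y ^ 2 ≤ (K + 1) / n := by
      rw [le_div_iff₀ hn]
      exact (mul_le_mul_of_nonneg_left (hmin' y hy) (sq_nonneg _)).trans hyK.le
    rw [← sq_abs] at this
    nlinarith [sq_nonneg (|u y| - 1), abs_nonneg (u y)]
  have hRT : R ≤ T := (le_abs_self R).trans (by simp [T])
  have hxT : x ∈ Icc (-T) T := ⟨by linarith [hx.1], hx.2.trans hRT⟩
  have hyT : y ∈ Icc (-T) T := ⟨by linarith [hy.1], by linarith [hy.2]⟩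
  have osc : |u x - u y| ≤ 1 / m * |K| + 2 * T / (4 * 1) := by
    have main : ∀ a ∈ Icc (-T) T, ∀ b ∈ Icc (-T) T, a ≤ b →
        |u b - u a| ≤ 1 / m * |K| + 2 * T / (4 * 1) := fun a ha b hb hab => by
      refine (h.sub_le hq0 hm one_pos hab fun t ht =>
        hmin t ⟨ha.1.trans ht.1, ht.2.trans hb.2⟩).trans ?_
      have := le_abs_self K
      gcongr
      linarith [ha.1, hb.2]
    rcases le_total x y with hxy | hxy
    · rw [abs_sub_comm]; exact main x hxT y hyT hxy
    · exact main y hyT x hxT hxy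
  have := abs_sub_abs_le_abs_sub (u x) (u y)
  linarith

/-- Uniform smallness of the mass at `+∞`, when `-(ς q)' / q → ∞` there. -/
theorem HasEnergyLE.exists_tail_le (hq : ContDiff ℝ 1 q) (hq0 : ∀ x, 0 < q x)
    (hς : ContDiff ℝ 1 ς) (hς0 : ∀ x, 0 < ς x)
    (ht : ∀ C : ℝ, ∃ R : ℝ, ∀ x, R ≤ x → C * q x ≤ -deriv (fun y => ς y * q y) x)
    (K : ℝ) {ε : ℝ} (hε : 0 < ε) :
    ∃ R₀, ∀ R, R₀ ≤ R → ∀ u g, HasEnergyLE q ς K u g → ∫ x in Ioi R, u x ^ 2 * q x ≤ ε := by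
  obtain ⟨a, ha⟩ := ht 0
  obtain ⟨M, hM⟩ := HasEnergyLE.exists_bound hq.continuous hq0 hς.continuous
    (fun x => (hς0 x).ne') K |a|
  -- `B` bounds the right side of `integral_sq_mul_le` for all `u`, `R`, `N`. Since `a` is fixed
  -- before `C`, `B` does not depend on `C`, and `C = (B + 1) / ε` is admissible.
  set B := M ^ 2 * (ς a * q a) + |K| + |K| with hB
  have hB0 : 0 ≤ B := by
    have := mul_pos (hς0 a) (hq0 a)
    positivity
  set C := (B + 1) / ε with hC
  have hC0 : 0 < C := by positivity
  obtain ⟨b, hb⟩ := ht C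
  refine ⟨max a b, fun R hR u g h => ?_⟩
  have haR := (le_max_left a b).trans hR
  have hbR := (le_max_right a b).trans hR
  have lim := intervalIntegral_tendsto_integral_Ioi R (f := fun x => u x ^ 2 * q x)
    h.integrable_sq.integrableOn tendsto_id
  refine le_of_tendsto lim ?_
  filter_upwards [eventually_ge_atTop R] with N hN
  have key := h.isPrimitive.integral_sq_mul_le hq.continuous (hς.mul hq) (fun _ => rfl) hq0 hς0
    haR hN (C := C) (fun x hx => by have := ha x hx; simp only [zero_mul] at this; linarith)
    (fun x hx => hb x (hbR.trans hx)) h.integrable_energy.intervalIntegrable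
  have k1 : ∫ x in a..N, u x ^ 2 * q x ≤ |K| := by
    rw [integral_of_le (haR.trans hN)]
    exact ((setIntegral_le_integral h.integrable_sq (.of_forall fun t =>
      mul_nonneg (sq_nonneg _) (hq0 t).le)).trans h.integral_sq_le).trans (le_abs_self K)
  have k2 : ∫ x in a..N, g x ^ 2 * ς x ^ 2 * q x ≤ |K| := by
    rw [integral_of_le (haR.trans hN)]
    exact ((setIntegral_le_integral h.integrable_energy (.of_forall fun t =>
      mul_nonneg (by positivity) (hq0 t).le)).trans h.integral_energy_le).trans (le_abs_self K)
  have k3 : u a ^ 2 * (ς a * q a) ≤ M ^ 2 * (ς a * q a) := by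
    have h1 := hM u g h a ⟨neg_abs_le a, le_abs_self a⟩
    have h2 : u a ^ 2 ≤ M ^ 2 := by rw [← sq_abs]; gcongr
    exact mul_le_mul_of_nonneg_right h2 (mul_pos (hς0 a) (hq0 a)).le
  have k4 : C * ∫ x in R..N, u x ^ 2 * q x ≤ C * ε := by
    have : C * ε = B + 1 := by rw [hC]; field_simp
    rw [this]
    linarith
  exact le_of_mul_le_mul_left k4 hC0

end Uniform

end NPC
-- Total boundedness in `L²` and the sign of `ς`.
namespace NPC

open Set intervalIntegral

section

variable {q ς : ℝ → ℝ}

theorem integrable_law_iff (hq : Measurable q) (hq0 : ∀ x, 0 < q x) (f : ℝ → ℝ) :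
    Integrable f (law q) ↔ Integrable fun x => f x * q x := by
  rw [law, integrable_withDensity_iff hq.ennreal_ofReal (by simp)]
  simp_rw [ENNReal.toReal_ofReal (hq0 _).le]

theorem integral_law (hq : Measurable q) (hq0 : ∀ x, 0 < q x) (f : ℝ → ℝ) :
    ∫ x, f x ∂law q = ∫ x, f x * q x := by
  rw [law, integral_withDensity_eq_integral_toReal_smul hq.ennreal_ofReal (by simp)]
  refine integral_congr_ae (.of_forall fun x => ?_)
  simp only [ENNReal.toReal_ofReal (hq0 x).le, smul_eq_mul, mul_comm]

theorem L2.integrable_sq_mul (hq : Measurable q) (hq0 : ∀ x, 0 < q x) (φ : L2 q) :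
    Integrable fun x => φ x ^ 2 * q x :=
  (integrable_law_iff hq hq0 _).1 (Lp.memLp φ).integrable_sq

theorem L2.inner_self_eq (hq : Measurable q) (hq0 : ∀ x, 0 < q x) (φ : L2 q) :
    inner ℝ φ φ = ∫ x, φ x ^ 2 * q x := by
  rw [MeasureTheory.L2.inner_def, ← integral_law hq hq0]
  refine integral_congr_ae (.of_forall fun x => ?_)
  simp [sq]

theorem L2.dist_sq_eq (hq : Measurable q) (hq0 : ∀ x, 0 < q x) {φ ψ : L2 q} {u v : ℝ → ℝ}
    (hφ : φ =ᵐ[volume] u) (hψ : ψ =ᵐ[volume] v) :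
    dist φ ψ ^ 2 = ∫ x, (u x - v x) ^ 2 * q x := by
  rw [dist_eq_norm, ← real_inner_self_eq_norm_sq, MeasureTheory.L2.inner_def,
    ← integral_law hq hq0]
  have hac : law q ≪ volume := withDensity_absolutelyContinuous _ _
  refine integral_congr_ae ?_
  filter_upwards [hac.ae_le hφ, hac.ae_le hψ, Lp.coeFn_sub φ ψ] with x h1 h2 h3
  rw [h3, Pi.sub_apply, h1, h2]
  simp [sq]

/-- A set of classes of functions of bounded energy with uniformly small tails is totally
bounded in `L²`. -/
theorem totallyBounded_of_hasEnergyLE (hq : Continuous q) (hq0 : ∀ x, 0 < q x)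
    (hq_int : Integrable q) (hς : Continuous ς) (hς0 : ∀ x, ς x ≠ 0) {K : ℝ} {S : Set (L2 q)}
    (hS : ∀ φ ∈ S, ∃ u g, HasEnergyLE q ς K u g ∧ φ =ᵐ[volume] u)
    (hright : ∀ ε : ℝ, 0 < ε → ∃ R₀, ∀ R, R₀ ≤ R → ∀ u g, HasEnergyLE q ς K u g →
      ∫ x in Ioi R, u x ^ 2 * q x ≤ ε)
    (hleft : ∀ ε : ℝ, 0 < ε → ∃ R₀, ∀ R, R₀ ≤ R → ∀ u g, HasEnergyLE q ς K u g →
      ∫ x in Iic (-R), u x ^ 2 * q x ≤ ε) :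
    TotallyBounded S := by
  choose! u g hE hu using hS
  refine Metric.totallyBounded_of_finite_discretization fun ε hε => ?_
  -- Budget for the squared distance: by `(a - b)² ≤ 2 a² + 2 b²` each tail costs `ε² / 8`. The
  -- middle costs `(3 δ)² I ≤ ε² / 4`, so the total is at most `ε² / 2`.
  obtain ⟨R₁, hR₁⟩ := hright (ε ^ 2 / 32) (by positivity)
  obtain ⟨R₂, hR₂⟩ := hleft (ε ^ 2 / 32) (by positivity)
  set R := max 0 (max R₁ R₂) with hR
  have hR0 : 0 ≤ R := le_max_left _ _
  have hRR₁ : R₁ ≤ R := (le_max_left _ _).trans (le_max_right _ _)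
  have hRR₂ : R₂ ≤ R := (le_max_right _ _).trans (le_max_right _ _)
  set I := ∫ x, q x with hI
  have hI0 : 0 ≤ I := integral_nonneg fun x => (hq0 x).le
  set δ := ε / (6 * (I + 1)) with hδ
  have hδ0 : 0 < δ := by positivity
  obtain ⟨r, hr, hosc⟩ := HasEnergyLE.exists_equicontinuous hq hq0 hς hς0 K R hδ0
  obtain ⟨M, hM⟩ := HasEnergyLE.exists_bound hq hq0 hς hς0 K R
  have hgrid : ∀ k : Fin (⌊2 * R / r⌋₊ + 1), -R + k * r ∈ Icc (-R) R := fun k => by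
    have h1 : (k : ℝ) ≤ 2 * R / r :=
      (Nat.cast_le.2 (Nat.lt_succ_iff.1 k.2)).trans (Nat.floor_le (by positivity))
    rw [le_div_iff₀ hr] at h1
    have : (0 : ℝ) ≤ k * r := by positivity
    constructor <;> linarith
  have hval : ∀ φ : S, ∀ k : Fin (⌊2 * R / r⌋₊ + 1),
      ⌊u φ (-R + k * r) / δ⌋ ∈ Finset.Icc ⌊-M / δ⌋ ⌊M / δ⌋ := fun φ k => by
    have h1 := abs_le.1 (hM _ _ (hE φ φ.2) _ (hgrid k))
    rw [Finset.mem_Icc]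
    exact ⟨Int.floor_mono (by gcongr; exact h1.1), Int.floor_mono (by gcongr; exact h1.2)⟩
  -- The finite code of `φ` records its values on a grid of mesh `r`, rounded down to multiples of
  -- `δ`. Equal codes give `3 δ`-closeness: one `δ` for the rounding, one for the oscillation of
  -- each function.
  refine ⟨Fin (⌊2 * R / r⌋₊ + 1) → Finset.Icc ⌊-M / δ⌋ ⌊M / δ⌋, inferInstance,
    fun φ k => ⟨⌊u φ (-R + k * r) / δ⌋, hval φ k⟩, fun φ ψ hF => ?_⟩
  have hEφ := hE φ φ.2
  have hEψ := hE ψ ψ.2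
  have close : ∀ x ∈ Icc (-R) R, |u φ x - u ψ x| ≤ 3 * δ := by
    intro x hx
    have hx0 : 0 ≤ (x + R) / r := div_nonneg (by linarith [hx.1]) hr.le
    set k := ⌊(x + R) / r⌋₊ with hk
    have hk1 : k < ⌊2 * R / r⌋₊ + 1 := Nat.lt_succ_iff.2 (Nat.floor_mono (by
      gcongr; linarith [hx.2]))
    have hk2 : k * r ≤ x + R := (le_div_iff₀ hr).1 (Nat.floor_le hx0)
    have hk3 : x + R < (k + 1) * r := (div_lt_iff₀ hr).1 (Nat.lt_floor_add_one _)
    have hg := hgrid ⟨k, hk1⟩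
    simp only at hg
    have o1 := hosc _ _ hEφ _ hg x hx (by linarith) (by linarith)
    have o2 := hosc _ _ hEψ _ hg x hx (by linarith) (by linarith)
    have o3 : |u φ (-R + k * r) - u ψ (-R + k * r)| ≤ δ := by
      have h1 := congrArg Subtype.val (congrFun hF ⟨k, hk1⟩)
      have h2 := Int.abs_sub_lt_one_of_floor_eq_floor h1
      simp only at h2
      rw [← sub_div, abs_div, abs_of_pos hδ0, div_lt_one hδ0] at h2
      exact h2.le
    rw [abs_le] at o1 o2 o3 ⊢
    constructor <;> linarith [o1.1, o1.2, o2.1, o2.2, o3.1, o3.2]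
  have iφ := hEφ.integrable_sq
  have iψ := hEψ.integrable_sq
  have le2 : ∀ x, (u φ x - u ψ x) ^ 2 * q x ≤ 2 * (u φ x ^ 2 * q x) + 2 * (u ψ x ^ 2 * q x) :=
    fun x => by nlinarith [mul_nonneg (hq0 x).le (sq_nonneg (u φ x + u ψ x))]
  have isum : Integrable fun x => 2 * (u φ x ^ 2 * q x) + 2 * (u ψ x ^ 2 * q x) :=
    (iφ.const_mul 2).add (iψ.const_mul 2)
  have id : Integrable fun x => (u φ x - u ψ x) ^ 2 * q x := by
    refine isum.mono ((((hEφ.isPrimitive.continuous.sub hEψ.isPrimitive.continuous).pow 2).mul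
      hq).aestronglyMeasurable) (.of_forall fun x => ?_)
    rw [Real.norm_of_nonneg (mul_nonneg (sq_nonneg _) (hq0 x).le)]
    exact (le2 x).trans (le_abs_self _)
  have tail : ∀ s : Set ℝ, ∫ x in s, u φ x ^ 2 * q x ≤ ε ^ 2 / 32 →
      ∫ x in s, u ψ x ^ 2 * q x ≤ ε ^ 2 / 32 →
      ∫ x in s, (u φ x - u ψ x) ^ 2 * q x ≤ ε ^ 2 / 8 := fun s h1 h2 => by
    refine (integral_mono id.integrableOn isum.integrableOn le2).trans ?_
    rw [integral_add (iφ.const_mul 2).integrableOn (iψ.const_mul 2).integrableOn,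
      MeasureTheory.integral_const_mul, MeasureTheory.integral_const_mul]
    linarith
  have mid : ∫ x in Ioc (-R) R, (u φ x - u ψ x) ^ 2 * q x ≤ ε ^ 2 / 4 := by
    have h1 : ∫ x in Ioc (-R) R, (u φ x - u ψ x) ^ 2 * q x ≤
        ∫ x in Ioc (-R) R, (3 * δ) ^ 2 * q x := by
      refine setIntegral_mono_on id.integrableOn (hq_int.const_mul _).integrableOn
        measurableSet_Ioc fun x hx => ?_
      have h2 : (u φ x - u ψ x) ^ 2 ≤ (3 * δ) ^ 2 := by
        rw [← sq_abs]; gcongr; exact close x (Ioc_subset_Icc_self hx)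
      exact mul_le_mul_of_nonneg_right h2 (hq0 x).le
    have h2 : ∫ x in Ioc (-R) R, q x ≤ I :=
      setIntegral_le_integral hq_int (.of_forall fun x => (hq0 x).le)
    rw [MeasureTheory.integral_const_mul] at h1
    have h3 : (3 * δ) ^ 2 * (I + 1) ^ 2 = ε ^ 2 / 4 := by rw [hδ]; field_simp; norm_num
    have h4 : (3 * δ) ^ 2 * ∫ x in Ioc (-R) R, q x ≤ (3 * δ) ^ 2 * (I + 1) ^ 2 := by
      gcongr; nlinarith
    linarith
  have split : ∫ x, (u φ x - u ψ x) ^ 2 * q x = (∫ x in Iic (-R), (u φ x - u ψ x) ^ 2 * q x) +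
      (∫ x in Ioc (-R) R, (u φ x - u ψ x) ^ 2 * q x) +
      ∫ x in Ioi R, (u φ x - u ψ x) ^ 2 * q x := by
    have hle : -R ≤ R := by linarith
    rw [← setIntegral_union (Iic_disjoint_Ioc le_rfl) measurableSet_Ioc id.integrableOn
      id.integrableOn, Iic_union_Ioc_eq_Iic hle, integral_Iic_add_Ioi id.integrableOn
      id.integrableOn]
  have t1 := tail _ (hR₂ R hRR₂ _ _ hEφ) (hR₂ R hRR₂ _ _ hEψ)
  have t2 := tail _ (hR₁ R hRR₁ _ _ hEφ) (hR₁ R hRR₁ _ _ hEψ)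
  have hd := L2.dist_sq_eq hq.measurable hq0 (hu φ φ.2) (hu ψ ψ.2)
  refine lt_of_pow_lt_pow_left₀ 2 hε.le ?_
  rw [hd, split]
  have : 0 < ε ^ 2 := by positivity
  linarith

/-- Members of the constraint set have primitives of uniformly bounded energy as
representatives. -/
theorem exists_hasEnergyLE_of_mem_constraintSet (hq : Continuous q) (hq0 : ∀ x, 0 < q x)
    (hς : Continuous ς) (hς0 : ∀ x, ς x ≠ 0) {θ : ℝ} (hθ : 0 < θ) {φ : L2 q}
    (hφ : φ ∈ constraintSet q (fun x => ς x ^ 2) θ) :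
    ∃ u g, HasEnergyLE q ς (2 + 1 / θ) u g ∧ φ =ᵐ[volume] u := by
  obtain ⟨hD, hle⟩ := hφ
  obtain ⟨hg, hi, hw⟩ := hD.choose_spec
  have hgrad : weakGrad q (fun x => ς x ^ 2) φ = hD.choose := dif_pos hD
  set g := hD.choose
  have hloc : LocallyIntegrable g volume := locallyIntegrable_of_energy hq hq0 (hς.pow 2)
    (fun x => sq_pos_of_ne_zero (hς0 x)) hg hi
  have iφ := L2.integrable_sq_mul hq.measurable hq0 φ
  -- With `S = 1` the energy lemma applies to `φ` itself in place of a derivative.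
  have hlocφ : LocallyIntegrable φ volume := locallyIntegrable_of_energy (S := fun _ => 1) hq hq0
    continuous_const (fun _ => one_pos) (Lp.stronglyMeasurable φ).measurable (by simpa using iφ)
  obtain ⟨u, hu, hφu⟩ := hw.exists_isPrimitive hlocφ hloc
  have ae : (fun x => φ x ^ 2 * q x) =ᵐ[volume] fun x => u x ^ 2 * q x := by
    filter_upwards [hφu] with x hx
    rw [hx]
  have e1 : form q (fun x => ς x ^ 2) φ φ = 1 / 2 * ∫ x, g x ^ 2 * ς x ^ 2 * q x := by
    rw [form, hgrad]
    congr 1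
    exact integral_congr_ae (.of_forall fun x => by ring)
  rw [e1, L2.inner_self_eq hq.measurable hq0, integral_congr_ae ae] at hle
  have p1 : 0 ≤ ∫ x, g x ^ 2 * ς x ^ 2 * q x := integral_nonneg fun x =>
    mul_nonneg (by positivity) (hq0 x).le
  have p2 : 0 ≤ ∫ x, u x ^ 2 * q x := integral_nonneg fun x =>
    mul_nonneg (by positivity) (hq0 x).le
  have p3 : 0 < 1 / θ := by positivity
  -- The constraint gives energy at most `2` and squared norm at most `1 / θ`; their sum serves for
  -- both.
  refine ⟨u, g, ⟨hu, iφ.congr ae, ?_, hi, ?_⟩, hφu⟩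
  · have : ∫ x, u x ^ 2 * q x ≤ 1 / θ := by
      rw [le_div_iff₀ hθ]; linarith
    linarith
  · have := mul_nonneg hθ.le p2
    linarith

/-- If `-ς q` is positive and has derivative at least `q` near `+∞`, then `1 / (ς² q)` is
integrable there, so a negative `ς` is excluded by the divergence hypothesis. -/
theorem lintegral_one_div_ne_top_of_neg (hq : ContDiff ℝ 1 q) (hq0 : ∀ x, 0 < q x)
    (hq_int : ∫⁻ x, ENNReal.ofReal (q x) ≠ ⊤) (hς : ContDiff ℝ 1 ς) (hς0 : ∀ x, ς x < 0)
    {R : ℝ} (hR : ∀ x, R ≤ x → q x ≤ -deriv (fun y => ς y * q y) x) :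
    ∫⁻ x in Ioi (0 : ℝ), ENNReal.ofReal (1 / (ς x ^ 2 * q x)) ≠ ⊤ := by
  have hcont : Continuous fun x => 1 / (ς x ^ 2 * q x) :=
    continuous_const.div ((hς.continuous.pow 2).mul hq.continuous) fun x =>
      (mul_pos (sq_pos_of_ne_zero (hς0 x).ne) (hq0 x)).ne'
  have hsub : Ioi (0 : ℝ) ⊆ Icc 0 R ∪ Ioi R := fun x hx => by
    rcases le_or_gt x R with h | h
    · exact Or.inl ⟨(mem_Ioi.1 hx).le, h⟩
    · exact Or.inr h
  refine ((lintegral_mono_set hsub).trans (lintegral_union_le _ _ _)).trans_lt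
    (ENNReal.add_lt_top.2 ⟨?_, ?_⟩) |>.ne
  · exact (hcont.integrableOn_Icc (μ := volume) (a := 0) (b := R)).lintegral_lt_top
  · have hanti : AntitoneOn (fun y => ς y * q y) (Ici R) := by
      refine antitoneOn_of_deriv_nonpos (convex_Ici R) (hς.mul hq).continuous.continuousOn
        ((hς.mul hq).differentiable one_ne_zero).differentiableOn fun x hx => ?_
      rw [interior_Ici] at hx
      have := hR x (mem_Ioi.1 hx).le
      have := hq0 x
      linarith
    -- Since `ς q` is negative and decreasing on `[R, ∞)`, `(ς q)² ≥ c`, hence `1 / (ς² q) = q / (ς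
    -- q)² ≤ q / c`.
    set c := (ς R * q R) ^ 2 with hc
    have hc0 : 0 < c := sq_pos_of_ne_zero (mul_neg_of_neg_of_pos (hς0 R) (hq0 R)).ne
    have hbd : ∀ x ∈ Ioi R, ENNReal.ofReal (1 / (ς x ^ 2 * q x)) ≤
        ENNReal.ofReal (1 / c) * ENNReal.ofReal (q x) := fun x hx => by
      rw [← ENNReal.ofReal_mul (by positivity)]
      refine ENNReal.ofReal_le_ofReal ?_
      have h1 : ς x * q x ≤ ς R * q R := hanti self_mem_Ici (mem_Ioi.1 hx).le (mem_Ioi.1 hx).le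
      have h2 : ς R * q R < 0 := mul_neg_of_neg_of_pos (hς0 R) (hq0 R)
      have h3 : c ≤ (ς x * q x) ^ 2 := by rw [hc]; nlinarith
      have h4 := hq0 x
      have h5 := sq_pos_of_ne_zero (hς0 x).ne
      rw [one_div_mul_eq_div, div_le_div_iff₀ (by positivity) hc0]
      nlinarith
    refine (setLIntegral_mono' measurableSet_Ioi hbd).trans_lt ?_
    rw [lintegral_const_mul _ hq.continuous.measurable.ennreal_ofReal]
    exact ENNReal.mul_lt_top ENNReal.ofReal_lt_top
      ((setLIntegral_le_lintegral _ _).trans_lt hq_int.lt_top)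

end

end NPC

/-! ### Assembly of the main theorem. -/

theorem mainTheorem4 (q ς : ℝ → ℝ)
    (hq : ContDiff ℝ 1 q) (hq_pos : ∀ x, 0 < q x)
    (hq_int : ∫⁻ x, ENNReal.ofReal (q x) = 1)
    (hς : ContDiff ℝ 1 ς) (hς_ne : ∀ x, ς x ≠ 0)
    (hdiv_right : ∫⁻ x in Set.Ioi (0 : ℝ), ENNReal.ofReal (1 / (ς x ^ 2 * q x)) = ⊤)
    (hdiv_left : ∫⁻ x in Set.Ioi (0 : ℝ), ENNReal.ofReal (1 / (ς (-x) ^ 2 * q (-x))) = ⊤)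
    (htail : Tendsto (fun x : ℝ => -(x / |x|) * (ς x * (deriv q x / q x) + deriv ς x))
      (comap (fun x : ℝ => |x|) atTop) atTop) :
    NPC.CompactnessCondition q (fun x => ς x ^ 2) := by
  have hqc := hq.continuous
  have hςc := hς.continuous
  have hder : ∀ x, deriv (fun y => ς y * q y) x = (ς x * (deriv q x / q x) + deriv ς x) * q x :=
    fun x => by
      rw [deriv_fun_mul (hς.differentiable one_ne_zero x) (hq.differentiable one_ne_zero x)]
      have := (hq_pos x).ne'
      field_simp
      ring
  have hq_int' : Integrable q := by
    refine ⟨hqc.aestronglyMeasurable, ?_⟩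
    rw [hasFiniteIntegral_iff_ofReal (.of_forall fun x => (hq_pos x).le), hq_int]
    exact ENNReal.one_lt_top
  have htail' : ∀ C : ℝ, ∃ R : ℝ, 0 < R ∧ ∀ x : ℝ, R ≤ |x| →
      C ≤ -(x / |x|) * (ς x * (deriv q x / q x) + deriv ς x) := fun C => by
    obtain ⟨R, -, hR⟩ := ((atTop_basis' (1 : ℝ)).comap fun x : ℝ => |x|).eventually_iff.1
      (tendsto_atTop.1 htail C)
    exact ⟨max R 1, by positivity, fun x hx => hR ((le_max_left R 1).trans hx)⟩
  have hright : ∀ C : ℝ, ∃ R : ℝ, ∀ x, R ≤ x → C * q x ≤ -deriv (fun y => ς y * q y) x :=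
    fun C => by
      obtain ⟨R, hR0, hR⟩ := htail' C
      refine ⟨R, fun x hx => ?_⟩
      have hx0 : 0 < x := hR0.trans_le hx
      have h1 := hR x (hx.trans (le_abs_self x))
      rw [abs_of_pos hx0, div_self hx0.ne'] at h1
      rw [hder]
      nlinarith [mul_le_mul_of_nonneg_right h1 (hq_pos x).le]
  have hleft : ∀ C : ℝ, ∃ R : ℝ, ∀ x, R ≤ x →
      C * q (-x) ≤ -deriv (fun y => ς (-y) * q (-y)) x := fun C => by
    obtain ⟨R, hR0, hR⟩ := htail' C
    refine ⟨R, fun x hx => ?_⟩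
    have hx0 : 0 < x := hR0.trans_le hx
    have h1 := hR (-x) (by rw [abs_neg]; exact hx.trans (le_abs_self x))
    rw [abs_neg, abs_of_pos hx0, neg_div, div_self hx0.ne'] at h1
    have e := deriv_comp_neg (fun y => ς y * q y) x
    rw [e, hder]
    nlinarith [mul_le_mul_of_nonneg_right h1 (hq_pos (-x)).le]
  -- A continuous `ς` without zeros has constant sign, and the negative sign contradicts the
  -- divergence at `+∞`.
  have hς_pos : ∀ x, 0 < ς x := by
    by_contra! hcon
    obtain ⟨x, hx⟩ := hcon
    have hneg : ∀ y, ς y < 0 := fun y => by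
      by_contra! hy
      obtain ⟨z, hz⟩ := mem_range_of_exists_le_of_exists_ge hςc ⟨x, hx⟩ ⟨y, hy⟩
      exact hς_ne z hz
    obtain ⟨R, hR⟩ := hright 1
    exact NPC.lintegral_one_div_ne_top_of_neg hq hq_pos (by simp [hq_int]) hς hneg
      (fun x hx => by simpa using hR x hx) hdiv_right
  intro θ hθ
  refine TotallyBounded.isCompact_of_isClosed (TotallyBounded.closure ?_) isClosed_closure
  refine NPC.totallyBounded_of_hasEnergyLE hqc hq_pos hq_int' hςc hς_ne
    (fun φ hφ => NPC.exists_hasEnergyLE_of_mem_constraintSet hqc hq_pos hςc hς_ne hθ hφ)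
    (fun ε hε => NPC.HasEnergyLE.exists_tail_le hq hq_pos hς hς_pos hright _ hε) fun ε hε => ?_
  -- The left tail is the right tail of the reflected data; `ς (-x)` is still positive, and `hleft`
  -- is the tail condition for it.
  obtain ⟨R₀, hR₀⟩ := NPC.HasEnergyLE.exists_tail_le (hq.comp contDiff_neg)
    (fun x => hq_pos (-x)) (hς.comp contDiff_neg) (fun x => hς_pos (-x)) hleft (2 + 1 / θ) hε
  refine ⟨R₀, fun R hR u g h => ?_⟩
  rw [← integral_comp_neg_Ioi]
  exact hR₀ R hR _ _ h.comp_neg
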